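/- Let $F$ be a euclidean field, i.e. a formally real field with $F=F^2\cup(-F^2)$ (where $F^2$ is the set of squares), let $n\ge 0$, and let $K=F((t_1))\cdots((t_n))$ be the iterated Laurent series field ($F_0=F$, $F_k=F_{k-1}((t_k))$, $K=F_n$). For $g\in K$ let $$\mathrm{PO}(g)=\Bigl\{\sigma_0+\sigma_1 g \;\Big|\; \sigma_0,\sigma_1\in\textstyle\sum K^2\Bigr\},$$ where $\sum K^2$ is the set of sums of squares in $K$; the sets $\mathrm{PO}(g)$ are called the monogenic quadratic modules of $K$. For $\varepsilon\in\{1,-1\}$ and $S\subseteq\{1,\dots,n\}$ put $t_S=\prod_{i\in S}t_i$ (so $t_\emptyset=1$). Then: 1. $\mathrm{PO}(1)=K^2$ and $\mathrm{PO}(-1)=K$. 2. The monogenic quadratic modules of $K$ are exactly the sets $\mathrm{PO}(\varepsilon t_S)$ with $\varepsilon\in\{1,-1\}$ and $S\subseteq\{1,\dots,n\}$, and they are pairwise distinct: $\mathrm{PO}(\varepsilon t_S)=\mathrm{PO}(\varepsilon' t_{S'})$ only if $\varepsilon=\varepsilon'$ and $S=S'$. 3. The only proper inclusions among them are those into $K$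 and those from $K^2$: one has $\mathrm{PO}(\varepsilon t_S)\subseteq \mathrm{PO}(\varepsilon' t_{S'})$ if and only if $(\varepsilon,S)=(\varepsilon',S')$, or $(\varepsilon,S)=(1,\emptyset)$, or $(\varepsilon',S')=(-1,\emptyset)$. 4. Every $f\in K$ can be written as $f=\varepsilon u^2t_1^{l_1}\cdots t_n^{l_n}$ with $\varepsilon\in\{1,-1\}$, $u\in K$ and $l_1,\dots,l_n\in\mathbb Z$. Whenever $u\neq 0$, one has $\mathrm{PO}(\varepsilon u^2t_1^{l_1}\cdots t_n^{l_n})=\mathrm{PO}(\varepsilon t_S)$ with $S=\{i : l_i \text{ is odd}\}$. Moreover $\mathrm{PO}(0)=\mathrm{PO}(1)$. -/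

import Mathlib

/-- A euclidean field: a formally real field `F` with `F = F² ∪ (-F²)`. -/
structure IsEuclideanField (F : Type*) [Field F] : Prop where
  formallyReal : IsFormallyReal F
  isSquare_or_isSquare_neg : ∀ a : F, IsSquare a ∨ IsSquare (-a)

/-- The iterated Laurent series field, bundled with its field structure:
`F_0 = F` and `F_(n+1) = F_n((t_(n+1)))`. -/
noncomputable def iteratedLaurentBundle (F : Type*) [hF : Field F] :
    ℕ → (K : Type _) × Field K
  | 0 => ⟨F, hF⟩
  | n + 1 =>
    letI : Field (iteratedLaurentBundle F n).1 := (iteratedLaurentBundle F n).2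
    ⟨LaurentSeries (iteratedLaurentBundle F n).1, inferInstance⟩

/-- The field `F((t_1))⋯((t_n))`. -/
def IteratedLaurent (F : Type*) [Field F] (n : ℕ) : Type _ :=
  (iteratedLaurentBundle F n).1

noncomputable instance IteratedLaurent.instField (F : Type*) [Field F] (n : ℕ) :
    Field (IteratedLaurent F n) :=
  (iteratedLaurentBundle F n).2

/-- The indeterminates of `F((t_1))⋯((t_n))`, numbered from `0` to `n - 1`. In the step from `n`
to `n + 1` the old ones are embedded as constants, and the last one is the variable of the
outermost Laurent series field. -/
noncomputable def IteratedLaurent.var (F : Type*) [Field F] :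
    (n : ℕ) → Fin n → IteratedLaurent F n
  | 0 => fun i => i.elim0
  | n + 1 =>
    (Fin.snoc (fun i => HahnSeries.C (IteratedLaurent.var F n i)) (HahnSeries.single (1 : ℤ) 1) :
      Fin (n + 1) → LaurentSeries (IteratedLaurent F n))

/-- `PO(g)`: the set of all `σ₀ + σ₁ g` with `σ₀`, `σ₁` sums of squares. -/
def PO {R : Type*} [CommRing R] (g : R) : Set R :=
  {x | ∃ σ₀ σ₁ : R, IsSumSq σ₀ ∧ IsSumSq σ₁ ∧ x = σ₀ + σ₁ * g}

/-- A monogenic quadratic module is a set of the form `PO(g)`. -/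
def IsMonogenicQuadraticModule {R : Type*} [CommRing R] (M : Set R) : Prop :=
  ∃ g : R, M = PO g

/-- The element `ε ∏_{i ∈ S} t_i` for a sign `ε` and a set `S` of indices. -/
noncomputable def IteratedLaurent.signedMonomial (F : Type*) [Field F] (n : ℕ)
    (ε : ℤˣ) (S : Finset (Fin n)) : IteratedLaurent F n :=
  ((ε : ℤ) : IteratedLaurent F n) * ∏ i ∈ S, IteratedLaurent.var F n i

/-! For nonzero g, `PO g` depends only on the square class of g, and PO(g) ⊆ PO(h) means g ∈ PO(h).
In a field with `IsSuperpythagorean`, sums of squares are squares and PO(h) = K² ∪ hK² whenever -h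
is not a square. Then the inclusion says that g or gh is a square; for nonzero h with -h a square,
PO(h) = K. A euclidean field has this property, and it passes from K to K((t)) because in
characteristic zero a nonzero series is its leading term times a square. The same fact, iterated,
shows that the elements ±t_S represent each nonzero square class exactly once, so everything reduces
to comparing signs and exponent parities. -/

/-- A Hahn series close to `1` over a field of characteristic zero is a square. -/
theorem HahnSeries.isSquare_of_orderTop_sub_one_pos {Γ K : Type*} [AddCommGroup Γ] [LinearOrder Γ]
    [IsOrderedAddMonoid Γ] [Field K] [CharZero K] {x : HahnSeries Γ K}
    (hx : 0 < (x - 1).orderTop) : IsSquare x := by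
  -- The root is the binomial series (1 + X)^(1/2) evaluated at x - 1.
  refine ⟨PowerSeries.heval (x - 1) (PowerSeries.binomialSeries K (1 / 2 : K)), ?_⟩
  rw [← map_mul, ← PowerSeries.binomialSeries_add, add_halves]
  have h := PowerSeries.binomialSeries_nat (R := K) (A := K) 1
  rw [Nat.cast_one, pow_one] at h
  rw [h, map_add, map_one, PowerSeries.heval_X _ hx]
  ring

/-! ### Squares and leading terms of Laurent series. -/

namespace LaurentSeries

variable {K : Type*} [Field K]

theorem order_inv {f : LaurentSeries K} (hf : f ≠ 0) : f⁻¹.order = -f.order := by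
  have h := HahnSeries.order_mul hf (inv_ne_zero hf)
  rw [mul_inv_cancel₀ hf, HahnSeries.order_one] at h
  omega

/-- Two nonzero Laurent series with the same leading term differ by a square. -/
theorem isSquare_div_of_order_eq_of_leadingCoeff_eq [CharZero K] {f g : LaurentSeries K}
    (hg : g ≠ 0) (ho : f.order = g.order) (hl : f.leadingCoeff = g.leadingCoeff) :
    IsSquare (f / g) := by
  have hf : f ≠ 0 := by
    rw [← HahnSeries.leadingCoeff_ne_zero, hl]
    exact HahnSeries.leadingCoeff_ne_zero.2 hg
  have hfg : f / g ≠ 0 := div_ne_zero hf hg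
  apply HahnSeries.isSquare_of_orderTop_sub_one_pos
  rw [HahnSeries.orderTop_self_sub_one_pos_iff]
  have hl' := HahnSeries.leadingCoeff_mul (f / g) g
  have ho' := HahnSeries.order_mul hfg hg
  rw [div_mul_cancel₀ _ hg] at hl' ho'
  constructor
  · rw [← HahnSeries.order_eq_orderTop_of_ne_zero hfg]
    have : (f / g).order = 0 := by omega
    rw [this]; rfl
  · have := HahnSeries.leadingCoeff_ne_zero.2 hg
    rw [hl] at hl'
    exact (mul_eq_right₀ this).1 hl'.symm

theorem order_C_mul_single {c : K} (hc : c ≠ 0) (l : ℤ) :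
    (HahnSeries.C c * HahnSeries.single l 1 : LaurentSeries K).order = l := by
  rw [HahnSeries.C_apply, HahnSeries.single_mul_single, zero_add, mul_one,
    HahnSeries.order_single hc]

theorem leadingCoeff_C_mul_single (c : K) (l : ℤ) :
    (HahnSeries.C c * HahnSeries.single l 1 : LaurentSeries K).leadingCoeff = c := by
  rw [HahnSeries.C_apply, HahnSeries.single_mul_single, mul_one,
    HahnSeries.leadingCoeff_of_single]

theorem C_mul_single_ne_zero {c : K} (hc : c ≠ 0) (l : ℤ) :
    (HahnSeries.C c * HahnSeries.single l 1 : LaurentSeries K) ≠ 0 := by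
  rw [← HahnSeries.leadingCoeff_ne_zero, leadingCoeff_C_mul_single]
  exact hc

/-- Every Laurent series agrees with its leading term up to the square of a unit. -/
theorem exists_eq_C_mul_single_mul_sq [CharZero K] {f : LaurentSeries K} (hf : f ≠ 0) :
    ∃ w : LaurentSeries K, w ≠ 0 ∧
      f = HahnSeries.C f.leadingCoeff * HahnSeries.single f.order 1 * w ^ 2 := by
  have hc := HahnSeries.leadingCoeff_ne_zero.2 hf
  have h0 := C_mul_single_ne_zero hc f.order
  obtain ⟨w, hw⟩ := isSquare_div_of_order_eq_of_leadingCoeff_eq h0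
    (order_C_mul_single hc f.order).symm (leadingCoeff_C_mul_single f.leadingCoeff f.order).symm
  refine ⟨w, ?_, ?_⟩
  · rintro rfl
    exact div_ne_zero hf h0 (by simpa using hw)
  · rw [sq, ← hw, mul_div_cancel₀ _ h0]

theorem isSquare_iff [CharZero K] {f : LaurentSeries K} (hf : f ≠ 0) :
    IsSquare f ↔ Even f.order ∧ IsSquare f.leadingCoeff := by
  constructor
  · rintro ⟨r, rfl⟩
    have hr : r ≠ 0 := by rintro rfl; simp at hf
    exact ⟨⟨r.order, HahnSeries.order_mul hr hr⟩, ⟨r.leadingCoeff, HahnSeries.leadingCoeff_mul r r⟩⟩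
  · rintro ⟨⟨m, hm⟩, hs⟩
    obtain ⟨w, -, hw⟩ := exists_eq_C_mul_single_mul_sq hf
    rw [hw]
    refine ((hs.map (HahnSeries.C (Γ := ℤ))).mul ⟨HahnSeries.single m 1, ?_⟩).mul (IsSquare.sq w)
    rw [HahnSeries.single_mul_single, one_mul, hm]

end LaurentSeries

/-! ### Superpythagorean fields and their Laurent series extensions. -/

/-- A field in which `-1` is not a square and `K² + gK² = K² ∪ gK²` for every `g ∉ -K²`. -/
structure IsSuperpythagorean (K : Type*) [Field K] : Prop where
  not_isSquare_neg_one : ¬ IsSquare (-1 : K)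
  rigid : ∀ g : K, IsSquare (-g) ∨ IsSquare (1 + g) ∨ IsSquare (g * (1 + g))

theorem isSquare_ringEquiv_iff {R S : Type*} [Semiring R] [Semiring S] (e : R ≃+* S) {x : R} :
    IsSquare (e x) ↔ IsSquare x :=
  ⟨fun h => by simpa using h.map e.symm, fun h => h.map e⟩

theorem IsSuperpythagorean.of_ringEquiv {K L : Type*} [Field K] [Field L]
    (hK : IsSuperpythagorean K) (e : K ≃+* L) : IsSuperpythagorean L where
  not_isSquare_neg_one h :=
    hK.not_isSquare_neg_one (by simpa using h.map e.symm)
  rigid g := by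
    have := hK.rigid (e.symm g)
    rw [← isSquare_ringEquiv_iff e, ← isSquare_ringEquiv_iff e (x := 1 + _),
      ← isSquare_ringEquiv_iff e (x := _ * _)] at this
    simpa using this

theorem IsFormallyReal.not_isSquare_neg_one (F : Type*) [Field F] [IsFormallyReal F] :
    ¬ IsSquare (-1 : F) := fun h =>
  one_ne_zero (IsFormallyReal.eq_zero_of_isSumSq_of_neg_isSumSq IsSumSq.one h.isSumSq)

theorem IsFormallyReal.charZero (F : Type*) [Field F] [IsFormallyReal F] : CharZero F := by
  refine charZero_of_inj_zero fun n hn => ?_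
  by_contra h
  obtain ⟨m, rfl⟩ := Nat.exists_eq_succ_of_ne_zero h
  rw [Nat.cast_succ] at hn
  exact one_ne_zero (IsFormallyReal.eq_zero_of_add_left (IsSumSq.natCast m) IsSumSq.one hn)

theorem IsEuclideanField.isSuperpythagorean {F : Type*} [Field F] (hF : IsEuclideanField F) :
    IsSuperpythagorean F where
  not_isSquare_neg_one :=
    have := hF.formallyReal
    IsFormallyReal.not_isSquare_neg_one F
  rigid g := by
    have := hF.formallyReal
    rcases hF.isSquare_or_isSquare_neg g with hg | hg
    · refine Or.inr (Or.inl ?_)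
      rcases hF.isSquare_or_isSquare_neg (1 + g) with h | h
      · exact h
      -- Both 1 + g and its negative are sums of squares here, so formal reality forces 1 + g = 0.
      · rw [IsFormallyReal.eq_zero_of_isSumSq_of_neg_isSumSq (IsSumSq.one.add hg.isSumSq)
          h.isSumSq]
        exact IsSquare.zero
    · exact Or.inl hg

/-- In 1 + g the term of lower order dominates: 1 + g has the square class of 1 if g has positive
order, and that of g if the order is negative. At order zero the question descends to the leading
coefficient. -/
theorem IsSuperpythagorean.laurentSeries {K : Type*} [Field K] [CharZero K]
    (hK : IsSuperpythagorean K) : IsSuperpythagorean (LaurentSeries K) where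
  not_isSquare_neg_one h := by
    rw [LaurentSeries.isSquare_iff (neg_ne_zero.2 one_ne_zero), HahnSeries.leadingCoeff_neg,
      HahnSeries.leadingCoeff_one] at h
    exact hK.not_isSquare_neg_one h.2
  rigid g := by
    have small : ∀ g : LaurentSeries K, 0 < g.orderTop → IsSquare (1 + g) := fun g hg =>
      HahnSeries.isSquare_of_orderTop_sub_one_pos (by rwa [add_sub_cancel_left])
    by_cases hg : g = 0
    · exact Or.inl (by simp [hg])
    rcases lt_trichotomy g.order 0 with h | h | h
    · refine Or.inr (Or.inr ?_)
      have h1 : g * (1 + g) = g ^ 2 * (1 + g⁻¹) := by field_simp; ring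
      rw [h1]
      refine (IsSquare.sq g).mul (small _ (HahnSeries.zero_lt_orderTop_of_order ?_))
      rw [LaurentSeries.order_inv hg]
      omega
    · have hc : g.leadingCoeff ≠ 0 := HahnSeries.leadingCoeff_ne_zero.2 hg
      by_cases hs : IsSquare (-g.leadingCoeff)
      · left
        rw [LaurentSeries.isSquare_iff (neg_ne_zero.2 hg), HahnSeries.order_neg, h,
          HahnSeries.leadingCoeff_neg]
        exact ⟨Even.zero, hs⟩
      -- The leading terms cannot cancel: otherwise the negated leading coefficient would be 1, a
      -- square.
      have hc1 : 1 + g.leadingCoeff ≠ 0 := fun h0 => hs (by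
        rw [← eq_neg_of_add_eq_zero_left h0]; exact IsSquare.one)
      have hcoeff : (1 + g).coeff 0 = 1 + g.leadingCoeff := by
        rw [HahnSeries.coeff_add, HahnSeries.leadingCoeff_eq, h, HahnSeries.coeff_one, if_pos rfl]
      have hne : 1 + g ≠ 0 := fun h0 => hc1 (by rw [← hcoeff, h0, HahnSeries.coeff_zero])
      have ho : (1 + g).order = 0 := by
        apply le_antisymm (HahnSeries.order_le_of_coeff_ne_zero (by rwa [hcoeff]))
        have := HahnSeries.min_order_le_order_add hne
        rwa [HahnSeries.order_one, h, min_self] at this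
      have hl : (1 + g).leadingCoeff = 1 + g.leadingCoeff := by
        rw [HahnSeries.leadingCoeff_eq, ho, hcoeff]
      rcases hK.rigid g.leadingCoeff with h1 | h1 | h1
      · exact absurd h1 hs
      · refine Or.inr (Or.inl ?_)
        rw [LaurentSeries.isSquare_iff hne, ho, hl]
        exact ⟨Even.zero, h1⟩
      · refine Or.inr (Or.inr ?_)
        rw [LaurentSeries.isSquare_iff (mul_ne_zero hg hne), HahnSeries.order_mul hg hne, ho, h,
          HahnSeries.leadingCoeff_mul, hl]
        exact ⟨Even.zero, h1⟩
    · exact Or.inr (Or.inl (small g (HahnSeries.zero_lt_orderTop_of_order h)))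

namespace IsSuperpythagorean

variable {K : Type*} [Field K]

/-- Dividing a² + b²g by a² reduces to rigidity of b²g/a², which lies in the square class of g. -/
theorem isSquare_sq_add_sq_mul_or (hK : IsSuperpythagorean K) {g : K} (hg : ¬ IsSquare (-g))
    {x y : K} (hx : IsSquare x) (hy : IsSquare y) :
    IsSquare (x + y * g) ∨ IsSquare (g * (x + y * g)) := by
  obtain ⟨a, rfl⟩ := hx
  obtain ⟨b, rfl⟩ := hy
  by_cases ha : a = 0
  · exact Or.inr ⟨b * g, by rw [ha]; ring⟩
  by_cases hb : b = 0
  · exact Or.inl ⟨a, by rw [hb]; ring⟩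
  have hsq : a ^ 2 * (1 + b ^ 2 * g / a ^ 2) = a * a + b * b * g := by field_simp
  have hneg : ¬ IsSquare (-(b ^ 2 * g / a ^ 2)) := fun h => hg (by
    have := h.mul (IsSquare.sq (a / b))
    rwa [show -(b ^ 2 * g / a ^ 2) * (a / b) ^ 2 = -g by field_simp] at this)
  rcases hK.rigid (b ^ 2 * g / a ^ 2) with h | h | h
  · exact absurd h hneg
  · left
    rw [← hsq]
    exact (IsSquare.sq a).mul h
  · right
    have := h.mul (IsSquare.sq (a * a / b))
    rwa [show b ^ 2 * g / a ^ 2 * (1 + b ^ 2 * g / a ^ 2) * (a * a / b) ^ 2 =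
      g * (a * a + b * b * g) by field_simp] at this

theorem isSquare_add (hK : IsSuperpythagorean K) {x y : K} (hx : IsSquare x) (hy : IsSquare y) :
    IsSquare (x + y) := by
  -- With g = 1 the two alternatives coincide.
  simpa using hK.isSquare_sq_add_sq_mul_or hK.not_isSquare_neg_one hx hy

theorem isSumSq_iff (hK : IsSuperpythagorean K) {x : K} : IsSumSq x ↔ IsSquare x := by
  refine ⟨fun h => ?_, IsSquare.isSumSq⟩
  induction h with
  | zero => exact IsSquare.zero
  | sq_add a _ ih => exact hK.isSquare_add (IsSquare.mul_self a) ih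

theorem mem_PO_iff (hK : IsSuperpythagorean K) {g : K} (hg : ¬ IsSquare (-g)) {x : K} :
    x ∈ PO g ↔ IsSquare x ∨ IsSquare (g * x) := by
  have hg0 : g ≠ 0 := by rintro rfl; simp at hg
  constructor
  · rintro ⟨x, y, hx, hy, rfl⟩
    exact hK.isSquare_sq_add_sq_mul_or hg (hK.isSumSq_iff.1 hx) (hK.isSumSq_iff.1 hy)
  · rintro (h | h)
    · exact ⟨x, 0, h.isSumSq, IsSumSq.zero, by simp⟩
    · refine ⟨0, g * x / g ^ 2, IsSumSq.zero, (h.div (IsSquare.sq g)).isSumSq, ?_⟩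
      field_simp
      simp

end IsSuperpythagorean

/-! ### Formal properties of `PO`. -/

section PO

variable {R : Type*} [CommRing R]

theorem self_mem_PO (g : R) : g ∈ PO g := ⟨0, 1, IsSumSq.zero, IsSumSq.one, by simp⟩

/-- `PO h` is closed under addition of sums of squares and multiplication by them, so only the
generator needs testing. -/
theorem PO_subset_iff {g h : R} : PO g ⊆ PO h ↔ g ∈ PO h := by
  refine ⟨fun H => H (self_mem_PO g), ?_⟩
  rintro ⟨a, b, ha, hb, rfl⟩ _ ⟨c, d, hc, hd, rfl⟩
  exact ⟨c + d * a, d * b, hc.add (hd.mul ha), hd.mul hb, by ring⟩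

theorem PO_zero_eq_PO_one : PO (0 : R) = PO 1 := by
  ext x
  constructor
  · rintro ⟨a, b, ha, hb, rfl⟩
    exact ⟨a, 0, ha, IsSumSq.zero, by simp⟩
  · rintro ⟨a, b, ha, hb, rfl⟩
    exact ⟨a + b, 0, ha.add hb, IsSumSq.zero, by simp⟩

theorem PO_neg_one {K : Type*} [Field K] [CharZero K] : PO (-1 : K) = Set.univ := by
  refine Set.eq_univ_of_forall fun x => ⟨((x + 1) / 2) * ((x + 1) / 2),
    ((x - 1) / 2) * ((x - 1) / 2), IsSumSq.mul_self _, IsSumSq.mul_self _, ?_⟩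
  ring

theorem PO_mul_sq {K : Type*} [Field K] (g : K) {u : K} (hu : u ≠ 0) :
    PO (g * u ^ 2) = PO g := by
  apply Set.Subset.antisymm <;> rw [PO_subset_iff]
  · exact ⟨0, u ^ 2, IsSumSq.zero, (IsSquare.sq u).isSumSq, by ring⟩
  · exact ⟨0, u⁻¹ ^ 2, IsSumSq.zero, (IsSquare.sq _).isSumSq, by field_simp; ring⟩

end PO

/-! ### Square classes of the iterated Laurent series field. -/

namespace IteratedLaurent

variable {F : Type*} [Field F]

/-- The definitional identification `F_(n+1) = F_n((t_(n+1)))`. -/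
noncomputable def succEquiv (F : Type*) [Field F] (n : ℕ) :
    IteratedLaurent F (n + 1) ≃+* LaurentSeries (IteratedLaurent F n) :=
  RingEquiv.refl (LaurentSeries (IteratedLaurent F n))

theorem succEquiv_var_castSucc (n : ℕ) (i : Fin n) :
    succEquiv F n (var F (n + 1) i.castSucc) = HahnSeries.C (var F n i) :=
  Fin.snoc_castSucc (α := fun _ => LaurentSeries (IteratedLaurent F n))
    (HahnSeries.single (1 : ℤ) 1) (fun i => HahnSeries.C (var F n i)) i

theorem succEquiv_var_last (n : ℕ) :
    succEquiv F n (var F (n + 1) (Fin.last n)) = HahnSeries.single (1 : ℤ) 1 :=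
  Fin.snoc_last (α := fun _ => LaurentSeries (IteratedLaurent F n))
    (HahnSeries.single (1 : ℤ) 1) (fun i => HahnSeries.C (var F n i))

/-- The definitional identification `F_0 = F`. -/
noncomputable def zeroEquiv (F : Type*) [Field F] : IteratedLaurent F 0 ≃+* F :=
  RingEquiv.refl F

theorem charZero [CharZero F] (n : ℕ) : CharZero (IteratedLaurent F n) := by
  induction n with
  | zero =>
    exact charZero_of_injective_ringHom (f := ((zeroEquiv F).symm : F →+* IteratedLaurent F 0))
      (zeroEquiv F).symm.injective
  | succ n ih =>
    exact charZero_of_injective_ringHom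
      (f := ((succEquiv F n).symm : _ →+* IteratedLaurent F (n + 1)).comp
        (HahnSeries.C : IteratedLaurent F n →+* LaurentSeries (IteratedLaurent F n)))
      ((succEquiv F n).symm.injective.comp HahnSeries.C_injective)

theorem isSuperpythagorean [CharZero F] (hF : IsSuperpythagorean F) (n : ℕ) :
    IsSuperpythagorean (IteratedLaurent F n) := by
  induction n with
  | zero => exact hF.of_ringEquiv (zeroEquiv F).symm
  | succ n ih =>
    have := charZero (F := F) n
    exact ih.laurentSeries.of_ringEquiv (succEquiv F n).symm

/-- The monomial `ε t_1^{l_1} ⋯ t_n^{l_n}`. -/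
noncomputable def monomial (F : Type*) [Field F] (n : ℕ) (ε : ℤˣ) (l : Fin n → ℤ) :
    IteratedLaurent F n :=
  ((ε : ℤ) : IteratedLaurent F n) * ∏ i, var F n i ^ l i

theorem zeroEquiv_monomial (ε : ℤˣ) (l : Fin 0 → ℤ) :
    zeroEquiv F (monomial F 0 ε l) = ((ε : ℤ) : F) := by
  simp [monomial]

theorem succEquiv_monomial (n : ℕ) (ε : ℤˣ) (l : Fin (n + 1) → ℤ) :
    succEquiv F n (monomial F (n + 1) ε l) =
      HahnSeries.C (monomial F n ε fun i => l i.castSucc) *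
        HahnSeries.single (l (Fin.last n)) 1 := by
  rw [monomial, map_mul, map_intCast, Fin.prod_univ_castSucc, map_mul, map_prod, map_zpow₀,
    succEquiv_var_last, ← RatFunc.single_zpow, monomial, map_mul, map_prod,
    map_intCast, mul_assoc]
  simp only [map_zpow₀, succEquiv_var_castSucc]

theorem monomial_ne_zero (n : ℕ) (ε : ℤˣ) (l : Fin n → ℤ) : monomial F n ε l ≠ 0 := by
  induction n with
  | zero =>
    rw [← (zeroEquiv F).map_ne_zero_iff, zeroEquiv_monomial]
    rcases Int.units_eq_one_or ε with rfl | rfl <;> simp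
  | succ n ih =>
    rw [← (succEquiv F n).map_ne_zero_iff, succEquiv_monomial]
    exact LaurentSeries.C_mul_single_ne_zero (ih _) _

/-- By induction: the last exponent is the order of the outermost series, and the remaining monomial
is its leading coefficient. -/
theorem isSquare_monomial_iff [CharZero F] (hF : ¬ IsSquare (-1 : F)) (n : ℕ) (ε : ℤˣ)
    (l : Fin n → ℤ) : IsSquare (monomial F n ε l) ↔ ε = 1 ∧ ∀ i, Even (l i) := by
  induction n with
  | zero =>
    rw [← isSquare_ringEquiv_iff (zeroEquiv F), zeroEquiv_monomial]
    rcases Int.units_eq_one_or ε with rfl | rfl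
    · simp
    · simpa using hF
  | succ n ih =>
    have := charZero (F := F) n
    have hne := monomial_ne_zero (F := F) n ε fun i => l i.castSucc
    rw [← isSquare_ringEquiv_iff (succEquiv F n), succEquiv_monomial,
      LaurentSeries.isSquare_iff (LaurentSeries.C_mul_single_ne_zero hne _),
      LaurentSeries.order_C_mul_single hne, LaurentSeries.leadingCoeff_C_mul_single, ih,
      Fin.forall_fin_succ']
    tauto

theorem exists_eq_monomial_mul_sq [CharZero F] (hF : ∀ a : F, IsSquare a ∨ IsSquare (-a))
    (n : ℕ) (f : IteratedLaurent F n) (hf : f ≠ 0) :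
    ∃ (ε : ℤˣ) (u : IteratedLaurent F n) (l : Fin n → ℤ),
      u ≠ 0 ∧ f = monomial F n ε l * u ^ 2 := by
  induction n with
  | zero =>
    have h0 : zeroEquiv F f ≠ 0 := (zeroEquiv F).map_ne_zero_iff.2 hf
    obtain ⟨ε, u, hu⟩ : ∃ (ε : ℤˣ) (u : F), zeroEquiv F f = (ε : ℤ) * u ^ 2 := by
      rcases hF (zeroEquiv F f) with ⟨u, hu⟩ | ⟨u, hu⟩
      · exact ⟨1, u, by rw [hu]; simp [sq]⟩
      · exact ⟨-1, u, by rw [← neg_neg (zeroEquiv F f), hu]; simp [sq]⟩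
    refine ⟨ε, (zeroEquiv F).symm u, 0, ?_, (zeroEquiv F).injective ?_⟩
    · rw [(zeroEquiv F).symm.map_ne_zero_iff]
      rintro rfl
      simp [hu] at h0
    · rw [map_mul, map_pow, zeroEquiv_monomial, RingEquiv.apply_symm_apply, hu]
  | succ n ih =>
    have := charZero (F := F) n
    have h0 : succEquiv F n f ≠ 0 := (succEquiv F n).map_ne_zero_iff.2 hf
    obtain ⟨w, hw0, hw⟩ := LaurentSeries.exists_eq_C_mul_single_mul_sq h0
    obtain ⟨ε, u, l, hu0, hu⟩ := ih _ (HahnSeries.leadingCoeff_ne_zero.2 h0)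
    refine ⟨ε, (succEquiv F n).symm (HahnSeries.C u * w),
      Fin.snoc (α := fun _ => ℤ) l (succEquiv F n f).order, ?_, (succEquiv F n).injective ?_⟩
    · rw [(succEquiv F n).symm.map_ne_zero_iff]
      exact mul_ne_zero (HahnSeries.C_ne_zero hu0) hw0
    · rw [map_mul, map_pow, succEquiv_monomial, RingEquiv.apply_symm_apply]
      simp only [Fin.snoc_castSucc, Fin.snoc_last]
      refine hw.trans ?_
      rw [hu, map_mul, map_pow]
      ring

theorem signedMonomial_eq_monomial (n : ℕ) (ε : ℤˣ) (S : Finset (Fin n)) :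
    signedMonomial F n ε S = monomial F n ε fun i => if i ∈ S then 1 else 0 := by
  rw [signedMonomial, monomial]
  congr 1
  rw [← Finset.prod_subset (Finset.subset_univ S)]
  · exact Finset.prod_congr rfl fun i hi => by simp [hi]
  · intro i _ hi; simp [hi]

theorem var_ne_zero (n : ℕ) (i : Fin n) : var F n i ≠ 0 := by
  intro h
  apply monomial_ne_zero (F := F) n 1 fun _ => 1
  rw [monomial, Finset.prod_eq_zero (Finset.mem_univ i) (by simp [h]), mul_zero]

theorem monomial_mul (n : ℕ) (ε ε' : ℤˣ) (l l' : Fin n → ℤ) :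
    monomial F n ε l * monomial F n ε' l' = monomial F n (ε * ε') (l + l') := by
  simp only [monomial, Pi.add_apply, zpow_add₀ (var_ne_zero n _), Finset.prod_mul_distrib,
    Units.val_mul, Int.cast_mul]
  ring

theorem PO_monomial (n : ℕ) (ε : ℤˣ) (l : Fin n → ℤ) :
    PO (monomial F n ε l) = PO (signedMonomial F n ε {i | Odd (l i)}) := by
  rw [signedMonomial_eq_monomial,
    -- Integer division rounds down, so l i - 2 * (l i / 2) is 0 or 1 for negative exponents too.
    ← PO_mul_sq (monomial F n ε fun i => if i ∈ ({i | Odd (l i)} : Finset (Fin n)) then 1 else 0)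
      (monomial_ne_zero n 1 fun i => l i / 2), sq, monomial_mul, monomial_mul]
  congr 2
  · simp
  · funext i
    simp only [Finset.mem_filter, Finset.mem_univ, true_and, Pi.add_apply]
    split_ifs with h
    · have := Int.odd_iff.1 h
      omega
    · have := Int.even_iff.1 (Int.not_odd_iff_even.1 h)
      omega

theorem isSquare_signedMonomial_iff [CharZero F] (hF : ¬ IsSquare (-1 : F)) (n : ℕ) (ε : ℤˣ)
    (S : Finset (Fin n)) : IsSquare (signedMonomial F n ε S) ↔ ε = 1 ∧ S = ∅ := by
  rw [signedMonomial_eq_monomial, isSquare_monomial_iff hF, Finset.eq_empty_iff_forall_notMem]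
  refine and_congr_right fun _ => forall_congr' fun i => ?_
  split_ifs with h <;> simp [h]

theorem isSquare_signedMonomial_mul_iff [CharZero F] (hF : ¬ IsSquare (-1 : F)) (n : ℕ)
    (ε ε' : ℤˣ) (S S' : Finset (Fin n)) :
    IsSquare (signedMonomial F n ε S * signedMonomial F n ε' S') ↔ ε = ε' ∧ S = S' := by
  rw [signedMonomial_eq_monomial, signedMonomial_eq_monomial, monomial_mul,
    isSquare_monomial_iff hF, Finset.ext_iff]
  refine and_congr ?_ (forall_congr' fun i => ?_)
  · rw [mul_eq_one_iff_eq_inv, Int.units_inv_eq_self]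
  · simp only [Pi.add_apply]
    split_ifs with h h' h' <;> simp [h, h']

theorem neg_signedMonomial (n : ℕ) (ε : ℤˣ) (S : Finset (Fin n)) :
    -signedMonomial F n ε S = signedMonomial F n (-ε) S := by
  simp [signedMonomial]

theorem PO_signedMonomial_subset_iff [CharZero F] (hF : IsSuperpythagorean F) (n : ℕ)
    (ε ε' : ℤˣ) (S S' : Finset (Fin n)) :
    PO (signedMonomial F n ε S) ⊆ PO (signedMonomial F n ε' S') ↔
      (ε = ε' ∧ S = S') ∨ (ε = 1 ∧ S = ∅) ∨ (ε' = -1 ∧ S' = ∅) := by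
  have := charZero (F := F) n
  rw [PO_subset_iff]
  -- The generator -1 is the only one in the list whose negative is a square, hence the only one
  -- outside the reach of `mem_PO_iff`.
  by_cases h : ε' = -1 ∧ S' = ∅
  · obtain ⟨rfl, rfl⟩ := h
    have h1 : signedMonomial F n (-1) ∅ = -1 := by simp [signedMonomial]
    simp [h1, PO_neg_one]
  · have hneg : ¬ IsSquare (-signedMonomial F n ε' S') := by
      rwa [neg_signedMonomial, isSquare_signedMonomial_iff hF.not_isSquare_neg_one, neg_eq_iff_eq_neg]
    rw [(isSuperpythagorean hF n).mem_PO_iff hneg, mul_comm,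
      isSquare_signedMonomial_iff hF.not_isSquare_neg_one,
      isSquare_signedMonomial_mul_iff hF.not_isSquare_neg_one]
    tauto

theorem PO_one_eq [CharZero F] (hF : IsSuperpythagorean F) (n : ℕ) :
    PO (1 : IteratedLaurent F n) = {x | IsSquare x} := by
  ext x
  have hK := isSuperpythagorean hF n
  simp [hK.mem_PO_iff hK.not_isSquare_neg_one]

end IteratedLaurent

theorem mainTheorem10 {F : Type*} [Field F] (hF : IsEuclideanField F) (n : ℕ) :
    -- the extreme modules: `PO(1) = K²` and `PO(-1) = K`
    PO (1 : IteratedLaurent F n) = {x : IteratedLaurent F n | IsSquare x} ∧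
    PO (-1 : IteratedLaurent F n) = Set.univ ∧
    -- the list `PO(ε ∏_{i ∈ S} t_i)` is complete
    (∀ M : Set (IteratedLaurent F n), IsMonogenicQuadraticModule M ↔
      ∃ (ε : ℤˣ) (S : Finset (Fin n)), M = PO (IteratedLaurent.signedMonomial F n ε S)) ∧
    -- the list is without repetition
    (∀ (ε ε' : ℤˣ) (S S' : Finset (Fin n)),
      PO (IteratedLaurent.signedMonomial F n ε S) =
        PO (IteratedLaurent.signedMonomial F n ε' S') → ε = ε' ∧ S = S') ∧
    -- all inclusions between members of the list
    (∀ (ε ε' : ℤˣ) (S S' : Finset (Fin n)),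
      PO (IteratedLaurent.signedMonomial F n ε S) ⊆
        PO (IteratedLaurent.signedMonomial F n ε' S') ↔
      (ε = ε' ∧ S = S') ∨ (ε = 1 ∧ S = ∅) ∨ (ε' = -1 ∧ S' = ∅)) ∧
    -- the normal form of elements, and the place of `PO(f)` in the list
    (∀ f : IteratedLaurent F n, ∃ (ε : ℤˣ) (u : IteratedLaurent F n) (l : Fin n → ℤ),
      f = ((ε : ℤ) : IteratedLaurent F n) * u ^ 2 * ∏ i, IteratedLaurent.var F n i ^ l i) ∧
    (∀ (ε : ℤˣ) (u : IteratedLaurent F n) (l : Fin n → ℤ), u ≠ 0 →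
      PO (((ε : ℤ) : IteratedLaurent F n) * u ^ 2 * ∏ i, IteratedLaurent.var F n i ^ l i) =
        PO (IteratedLaurent.signedMonomial F n ε {i | Odd (l i)})) ∧
    PO (0 : IteratedLaurent F n) = PO (1 : IteratedLaurent F n) := by
  have := hF.formallyReal
  have := IsFormallyReal.charZero F
  have := IteratedLaurent.charZero (F := F) n
  have hS := hF.isSuperpythagorean
  have hPO : ∀ (ε : ℤˣ) (u : IteratedLaurent F n) (l : Fin n → ℤ), u ≠ 0 →
      PO (((ε : ℤ) : IteratedLaurent F n) * u ^ 2 * ∏ i, IteratedLaurent.var F n i ^ l i) =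
        PO (IteratedLaurent.signedMonomial F n ε {i | Odd (l i)}) := fun ε u l hu => by
    rw [mul_right_comm, PO_mul_sq _ hu]
    exact IteratedLaurent.PO_monomial n ε l
  refine ⟨IteratedLaurent.PO_one_eq hS n, PO_neg_one, fun M => ⟨?_, ?_⟩, fun ε ε' S S' h => ?_,
    IteratedLaurent.PO_signedMonomial_subset_iff hS n, fun f => ?_, hPO, PO_zero_eq_PO_one⟩
  · rintro ⟨g, rfl⟩
    by_cases hg : g = 0
    · exact ⟨1, ∅, by simp [hg, PO_zero_eq_PO_one, IteratedLaurent.signedMonomial]⟩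
    · obtain ⟨ε, u, l, hu, rfl⟩ :=
        IteratedLaurent.exists_eq_monomial_mul_sq hF.isSquare_or_isSquare_neg n g hg
      exact ⟨ε, _, (PO_mul_sq _ hu).trans (IteratedLaurent.PO_monomial n ε l)⟩
  · rintro ⟨ε, S, rfl⟩
    exact ⟨_, rfl⟩
  · have h1 := (IteratedLaurent.PO_signedMonomial_subset_iff hS n ε ε' S S').1 h.subset
    have h2 := (IteratedLaurent.PO_signedMonomial_subset_iff hS n ε' ε S' S).1 h.superset
    have h3 : (1 : ℤˣ) ≠ -1 := by decide
    -- In the two opposite inclusions, every mixed case either gives equal labels or forces 1 = -1.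
    grind
  · by_cases hf : f = 0
    · exact ⟨1, 0, 0, by simp [hf]⟩
    · obtain ⟨ε, u, l, -, rfl⟩ :=
        IteratedLaurent.exists_eq_monomial_mul_sq hF.isSquare_or_isSquare_neg n f hf
      exact ⟨ε, u, l, mul_right_comm _ _ _⟩
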